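/- Let $K$ be a field and let $n\ge 3$ be an integer. Let $S_n$ be the monoid defined by generators $a_1,a_2,\dots,a_n$ and the relations $a_1a_2\cdots a_n=a_{\sigma(1)}a_{\sigma(2)}\cdots a_{\sigma(n)}$, where $\sigma$ runs through the cyclic subgroup of the symmetric group $\operatorname{Sym}_n$ generated by the cycle $(1,2,\dots,n)$. Then the semigroup algebra $K[S_n]$ is a domain (not necessarily commutative), and it is semiprimitive, i.e. its Jacobson radical is zero. -/

import Mathlib

/-- The word `a_{σ(1)} a_{σ(2)} ⋯ a_{σ(n)}` in the free monoid on `a_1, …, a_n`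
(the generators are indexed by `Fin n`, that is, from `0` to `n - 1`). -/
def permWord {n : ℕ} (σ : Equiv.Perm (Fin n)) : FreeMonoid (Fin n) :=
  (List.ofFn fun i : Fin n => FreeMonoid.of (σ i)).prod

/-- The defining relations `a_1 a_2 ⋯ a_n = a_{σ(1)} a_{σ(2)} ⋯ a_{σ(n)}`, for `σ ∈ H`. -/
def PermRel {n : ℕ} (H : Set (Equiv.Perm (Fin n))) (u v : FreeMonoid (Fin n)) : Prop :=
  ∃ σ ∈ H, u = permWord 1 ∧ v = permWord σ

/-- The monoid `S_n(H)` with generators `a_1, …, a_n` and relations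
`a_1 a_2 ⋯ a_n = a_{σ(1)} a_{σ(2)} ⋯ a_{σ(n)}`, for `σ ∈ H`. -/
abbrev PermMonoid (n : ℕ) (H : Set (Equiv.Perm (Fin n))) : Type :=
  PresentedMonoid (PermRel H)

/-- The monoid `S_n = S_n(H)` for `H` the cyclic subgroup of `Sym_n` generated by the
cycle `(1, 2, …, n)`, which is `finRotate n`. -/
abbrev CyclicPermMonoid (n : ℕ) : Type :=
  PermMonoid n (Subgroup.zpowers (finRotate n) : Set (Equiv.Perm (Fin n)))

/-! The element `z = a_1 ⋯ a_n` is central, and deleting cyclic factors of length `n` writes each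
element as `z ^ k` times a reduced word. Letters permute the reduced words and full rotations act
trivially, so the action factors through the free group `⟨a_1, …, a_n | a_1 ⋯ a_n = 1⟩`; the image
there determines the reduced word, and length then determines `k`. Hence `S_n` embeds in a free
group times `ℕ` (`toFreeGroup_prod_length_injective`), so it has unique products and `K[S_n]` is a
domain. In a domain graded by length, `1 + a x` has positive degree for a letter `a` and `x ≠ 0`, so
it is not invertible and the radical vanishes. -/

/-! ### Unique products in free groups -/

/-- A group has unique products as soon as every finite set with a nontrivial element lies in a
subgroup with a homomorphism to `ℤ` that does not vanish on that set. -/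
theorem UniqueProds.of_exists_hom_int {G : Type*} [Group G]
    (h : ∀ S : Set G, (∃ s ∈ S, s ≠ 1) → ∃ (H : Subgroup G) (φ : G → ℤ), S ⊆ H ∧
      (∀ x ∈ H, ∀ y ∈ H, φ (x * y) = φ x + φ y) ∧ ∃ s ∈ S, φ s ≠ 0) :
    UniqueProds G := by
  classical
  refine ⟨fun {A B} hA hB => ?_⟩
  induction hm : A.card + B.card using Nat.strong_induction_on generalizing A B with
  | _ m ih =>
  obtain ⟨a, ha⟩ := hA
  obtain ⟨b, hb⟩ := hB
  -- Translating `a` and `b` to `1` makes both sets lie in `H`.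
  set S : Set G := (fun x => a⁻¹ * x) '' A ∪ (fun y => y * b⁻¹) '' B with hS
  by_cases hS1 : ∃ s ∈ S, s ≠ 1
  · obtain ⟨H, φ, hSH, hφ, s, hs, hs0⟩ := h S hS1
    have hAH : ∀ x ∈ A, a⁻¹ * x ∈ H := fun x hx => hSH (Or.inl ⟨x, hx, rfl⟩)
    have hBH : ∀ y ∈ B, y * b⁻¹ ∈ H := fun y hy => hSH (Or.inr ⟨y, hy, rfl⟩)
    have h1 : φ 1 = 0 := by simpa using hφ 1 H.one_mem 1 H.one_mem
    obtain ⟨x₁, hx₁, hmaxA⟩ := A.exists_max_image (fun x => φ (a⁻¹ * x)) ⟨a, ha⟩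
    obtain ⟨y₁, hy₁, hmaxB⟩ := B.exists_max_image (fun y => φ (y * b⁻¹)) ⟨b, hb⟩
    set A' := A.filter fun x => φ (a⁻¹ * x) = φ (a⁻¹ * x₁)
    set B' := B.filter fun y => φ (y * b⁻¹) = φ (y₁ * b⁻¹)
    -- If both faces were everything, `φ` would be constant on each translate, hence `0` there
    -- because each contains `1`.
    have hlt : A'.card + B'.card < m := by
      have hAc : A'.card ≤ A.card := Finset.card_filter_le _ _
      have hBc : B'.card ≤ B.card := Finset.card_filter_le _ _
      by_contra hge
      have hAe : A' = A := Finset.eq_of_subset_of_card_le (Finset.filter_subset _ _) (by omega)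
      have hBe : B' = B := Finset.eq_of_subset_of_card_le (Finset.filter_subset _ _) (by omega)
      rw [Finset.filter_eq_self] at hAe hBe
      rcases hs with ⟨x, hx, rfl⟩ | ⟨y, hy, rfl⟩
      · apply hs0
        have := hAe a ha
        rw [inv_mul_cancel, h1] at this
        exact (hAe x hx).trans this.symm
      · apply hs0
        have := hBe b hb
        rw [mul_inv_cancel, h1] at this
        exact (hBe y hy).trans this.symm
    obtain ⟨a₀, ha₀, b₀, hb₀, hu⟩ := ih _ hlt (A := A') (B := B')
      ⟨x₁, Finset.mem_filter.2 ⟨hx₁, rfl⟩⟩ ⟨y₁, Finset.mem_filter.2 ⟨hy₁, rfl⟩⟩ rfl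
    rw [Finset.mem_filter] at ha₀ hb₀
    refine ⟨a₀, ha₀.1, b₀, hb₀.1, fun x y hx hy hxy => ?_⟩
    -- Both summands on the right are maximal, so equality of sums forces `x` and `y` into the
    -- faces.
    have e : φ (a⁻¹ * x) + φ (y * b⁻¹) = φ (a⁻¹ * a₀) + φ (b₀ * b⁻¹) := by
      rw [← hφ _ (hAH x hx) _ (hBH y hy), ← hφ _ (hAH _ ha₀.1) _ (hBH _ hb₀.1)]
      congr 1
      calc a⁻¹ * x * (y * b⁻¹) = a⁻¹ * (x * y) * b⁻¹ := by group
        _ = _ := by rw [hxy]; group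
    have hxm := hmaxA x hx
    have hym := hmaxB y hy
    have := ha₀.2
    have := hb₀.2
    exact hu (Finset.mem_filter.2 ⟨hx, by omega⟩) (Finset.mem_filter.2 ⟨hy, by omega⟩) hxy
  · push Not at hS1
    have hAe : ∀ x ∈ A, x = a := fun x hx =>
      (inv_mul_eq_one.1 (hS1 _ (Or.inl ⟨x, hx, rfl⟩))).symm
    have hBe : ∀ y ∈ B, y = b := fun y hy =>
      mul_inv_eq_one.1 (hS1 _ (Or.inr ⟨y, hy, rfl⟩))
    exact ⟨a, ha, b, hb, fun x y hx hy _ => ⟨hAe x hx, hBe y hy⟩⟩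

/-- A nontrivial free group has a nontrivial homomorphism to `ℤ`. -/
theorem IsFreeGroup.exists_hom_int_ne_one (G : Type*) [Group G] [IsFreeGroup G] [Nontrivial G] :
    ∃ φ : G →* Multiplicative ℤ, φ ≠ 1 := by
  refine ⟨IsFreeGroup.lift fun _ => Multiplicative.ofAdd 1, fun h => ?_⟩
  have : IsEmpty (IsFreeGroup.Generators G) := ⟨fun x => by
    have := DFunLike.congr_fun h (IsFreeGroup.of x)
    rw [IsFreeGroup.lift_of] at this
    exact absurd (Multiplicative.ofAdd.injective this) one_ne_zero⟩
  have hid : MonoidHom.id G = 1 := IsFreeGroup.ext_hom fun x => isEmptyElim x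
  obtain ⟨g, hg⟩ := exists_ne (1 : G)
  exact hg (DFunLike.congr_fun hid g)

/-- By Nielsen–Schreier, the subgroup generated by `S` is free, and a nontrivial map to `ℤ` cannot
vanish on its generators. -/
theorem uniqueProds_freeGroup (α : Type*) : UniqueProds (FreeGroup α) := by
  classical
  refine UniqueProds.of_exists_hom_int fun S ⟨s, hs, hs1⟩ => ?_
  have hsub : S ⊆ Subgroup.closure S := Subgroup.subset_closure
  have : Nontrivial (Subgroup.closure S) :=
    ⟨⟨s, hsub hs⟩, 1, fun h => hs1 (congrArg Subtype.val h)⟩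
  obtain ⟨φ, hφ⟩ := IsFreeGroup.exists_hom_int_ne_one (Subgroup.closure S)
  refine ⟨Subgroup.closure S, fun x => if hx : x ∈ Subgroup.closure S then (φ ⟨x, hx⟩).toAdd else 0,
    hsub, fun x hx y hy => ?_, ?_⟩
  · simp only [hx, hy, mul_mem hx hy, dite_true]
    rw [← toAdd_mul, ← map_mul]
    rfl
  · by_contra! hcon
    apply hφ
    refine MonoidHom.ext fun ⟨x, hx⟩ => ?_
    induction hx using Subgroup.closure_induction with
    | mem x hx =>
      have := hcon x hx
      rw [dif_pos (show x ∈ Subgroup.closure S from hsub hx)] at this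
      exact this
    | one => exact map_one φ
    | mul x y hx hy ihx ihy =>
      have := map_mul φ ⟨x, hx⟩ ⟨y, hy⟩
      rw [ihx, ihy] at this
      exact this
    | inv x hx ihx =>
      have := map_inv φ ⟨x, hx⟩
      rw [ihx] at this
      exact this

/-! ### Cyclic words and the action on reduced words -/

/-- The cyclically consecutive word `i, i + 1, …, i + m - 1` of length `m`. -/
def cycWord {n : ℕ} [NeZero n] (i : Fin n) : ℕ → List (Fin n)
  | 0 => []
  | m + 1 => i :: cycWord (i + 1) m

section CycWord

open scoped Fin.CommRing

variable {n : ℕ} [NeZero n]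

theorem length_cycWord (i : Fin n) (m : ℕ) : (cycWord i m).length = m := by
  induction m generalizing i with
  | zero => rfl
  | succ m ih => simp [cycWord, ih]

theorem cycWord_succ' (i : Fin n) (m : ℕ) :
    cycWord i (m + 1) = cycWord i m ++ [i + (m : Fin n)] := by
  induction m generalizing i with
  | zero => simp [cycWord]
  | succ m ih =>
    rw [cycWord, ih]
    simp [cycWord, add_assoc, add_comm (1 : Fin n)]

theorem cycWord_card_succ (i : Fin n) : i :: cycWord (i + 1) n = cycWord i n ++ [i] := by
  have := cycWord_succ' i n
  rwa [Fin.natCast_self, add_zero] at this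

theorem succ_add_card_sub_one (i : Fin n) : i + 1 + ((n - 1 : ℕ) : Fin n) = i := by
  have : ((n - 1 + 1 : ℕ) : Fin n) = 0 := by
    rw [Nat.sub_add_cancel (NeZero.pos n), Fin.natCast_self]
  push_cast at this
  rw [add_assoc, add_comm 1, this, add_zero]

theorem cycWord_card_eq_cons (i : Fin n) : cycWord i n = i :: cycWord (i + 1) (n - 1) := by
  have (k : ℕ) (hk : n - 1 + 1 = k) : cycWord i k = i :: cycWord (i + 1) (n - 1) := by
    subst hk
    rfl
  exact this n (Nat.sub_add_cancel (NeZero.pos n))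

theorem cycWord_card_eq_append (i : Fin n) :
    cycWord i n = cycWord i (n - 1) ++ [i + ((n - 1 : ℕ) : Fin n)] := by
  rw [← cycWord_succ', Nat.sub_add_cancel (NeZero.pos n)]

theorem cycWord_eq_map (i : Fin n) (m : ℕ) :
    cycWord i m = (List.range m).map fun k : ℕ => i + (k : Fin n) := by
  induction m with
  | zero => rfl
  | succ m ih => rw [cycWord_succ', ih, List.range_succ]; simp

/-- A word is reduced if it has no cyclically consecutive factor of length `n`. -/
def IsCycReduced : List (Fin n) → Prop
  | [] => True
  | i :: l => IsCycReduced l ∧ ¬ cycWord (i + 1) (n - 1) <+: l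

theorem IsCycReduced.of_append {u v : List (Fin n)} (h : IsCycReduced (u ++ v)) :
    IsCycReduced v := by
  induction u with
  | nil => exact h
  | cons i u ih => exact ih h.1

open Classical in
/-- Left multiplication by a letter on reduced words. -/
noncomputable def cycPush (i : Fin n) (l : List (Fin n)) : List (Fin n) :=
  if cycWord (i + 1) (n - 1) <+: l then l.drop (n - 1) else i :: l

theorem cycPush_of_not {i : Fin n} {l : List (Fin n)} (h : ¬ cycWord (i + 1) (n - 1) <+: l) :
    cycPush i l = i :: l := if_neg h

theorem cycPush_append (i : Fin n) (l : List (Fin n)) :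
    cycPush i (cycWord (i + 1) (n - 1) ++ l) = l := by
  rw [cycPush, if_pos (List.prefix_append _ _)]
  exact List.drop_left' (length_cycWord _ _)

theorem IsCycReduced.push {l : List (Fin n)} (h : IsCycReduced l) (i : Fin n) :
    IsCycReduced (cycPush i l) := by
  by_cases hl : cycWord (i + 1) (n - 1) <+: l
  · obtain ⟨v, rfl⟩ := hl
    rw [cycPush_append]
    exact h.of_append
  · rw [cycPush_of_not hl]
    exact ⟨h, hl⟩

/-- A deletion would need the letter `j` right after the letters already pushed, but the head of `l`
stands there. -/
theorem foldr_cycPush_cycWord_of_head_ne {j : Fin n} {l : List (Fin n)} (hj : l.head? ≠ some j)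
    (i : Fin n) {m : ℕ} (hm : m ≤ n - 1) (hi : i + (m : Fin n) = j) :
    (cycWord i m).foldr cycPush l = cycWord i m ++ l := by
  induction m generalizing i with
  | zero => rfl
  | succ m ih =>
    have hi' : i + 1 + (m : Fin n) = j := by rw [← hi]; push_cast; ring
    rw [cycWord, List.foldr_cons, ih (i + 1) (by omega) hi', cycPush_of_not]
    · rfl
    rintro ⟨t, ht⟩
    have hget : (cycWord (i + 1) (n - 1))[m]? = some j := by
      rw [cycWord_eq_map, List.getElem?_map, List.getElem?_range (by omega), Option.map_some, hi']
    have h2 := congrArg (fun u => u[m]?) ht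
    rw [List.getElem?_append_left (by rw [length_cycWord]; omega), hget,
      List.getElem?_append_right (by rw [length_cycWord]),
      length_cycWord, Nat.sub_self,
      ← List.head?_eq_getElem?] at h2
    exact hj h2.symm

/-- Every rotation of the full cycle acts trivially on reduced words. -/
theorem foldr_cycPush_cycWord_card {l : List (Fin n)} (hl : IsCycReduced l) (i : Fin n) :
    (cycWord i n).foldr cycPush l = l := by
  -- The last `n - 1` letters pile up without deletion, then the first letter `i` cancels them all.
  have key : ∀ {l : List (Fin n)} (i : Fin n), l.head? ≠ some i →
      (cycWord i n).foldr cycPush l = l := fun {l} i hi => by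
    rw [cycWord_card_eq_cons, List.foldr_cons,
      foldr_cycPush_cycWord_of_head_ne hi _ le_rfl (succ_add_card_sub_one i), cycPush_append]
  induction l generalizing i with
  | nil => exact key i (by simp)
  | cons j l ih =>
    by_cases hij : i = j
    · subst hij
      -- The word `i, i + 1, …, i` is `i` times one rotation and also another rotation times `i`;
      -- the first acts trivially on the tail by induction.
      have h := congrArg (List.foldr cycPush l) (cycWord_card_succ i)
      rw [List.foldr_cons, ih hl.1, List.foldr_append, List.foldr_cons, List.foldr_nil,
        cycPush_of_not hl.2] at h
      exact h.symm
    · exact key i (by simpa using Ne.symm hij)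

end CycWord

/-! ### Rotations and the defining relations -/

section Rotations

open scoped Fin.CommRing

variable {n : ℕ} [NeZero n]

theorem finRotate_eq_addRight : finRotate n = Equiv.addRight 1 :=
  Equiv.ext fun i => finRotate_apply i

theorem mem_zpowers_finRotate_iff {σ : Equiv.Perm (Fin n)} :
    σ ∈ Subgroup.zpowers (finRotate n) ↔ ∃ j : Fin n, ∀ i, σ i = j + i := by
  rw [finRotate_eq_addRight]
  constructor
  · rintro ⟨k, rfl⟩
    exact ⟨k • 1, fun i => by simp [add_comm]⟩
  · rintro ⟨j, hj⟩
    refine ⟨(j : ℕ), Equiv.ext fun i => ?_⟩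
    simp [hj, add_comm]

theorem permWord_eq_ofList_cycWord {σ : Equiv.Perm (Fin n)} {j : Fin n} (h : ∀ i, σ i = j + i) :
    permWord σ = FreeMonoid.ofList (cycWord j n) := by
  have h1 : cycWord j n = List.ofFn σ := by
    rw [cycWord_eq_map]
    refine List.ext_getElem (by simp) fun k hk _ => ?_
    have hk' : k < n := by simpa using hk
    simp only [List.getElem_map, List.getElem_range, List.getElem_ofFn, h]
    congr 1
    exact Fin.ext (by simp [Nat.mod_eq_of_lt hk'])
  have h2 (l : List (Fin n)) : (l.map FreeMonoid.of).prod = FreeMonoid.ofList l := by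
    induction l with
    | nil => rfl
    | cons i l ih => rw [List.map_cons, List.prod_cons, ih, FreeMonoid.ofList_cons]
  rw [h1, ← h2, permWord, List.map_ofFn]
  rfl

theorem prod_map_cycWord_eq_one {G : Type*} [Group G] {f : Fin n → G}
    (h : ((cycWord 0 n).map f).prod = 1) (j : Fin n) : ((cycWord j n).map f).prod = 1 := by
  have hstep (i : Fin n) (hi : ((cycWord i n).map f).prod = 1) :
      ((cycWord (i + 1) n).map f).prod = 1 := by
    have := congrArg (fun l => (List.map f l).prod) (cycWord_card_succ i)
    simpa [hi] using this
  have (k : ℕ) : ((cycWord (k : Fin n) n).map f).prod = 1 := by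
    induction k with
    | zero => simpa using h
    | succ k ih => simpa using hstep _ ih
  simpa using this (j : ℕ)

end Rotations

/-! ### Normal forms and the embedding of the monoid -/

namespace CyclicPermMonoid

open scoped Fin.CommRing

variable {n : ℕ}

/-- The generators of `S_n`. -/
def gen (i : Fin n) : CyclicPermMonoid n := PresentedMonoid.of _ i

/-- The element of `S_n` represented by a word. -/
def ofWord (l : List (Fin n)) : CyclicPermMonoid n := (l.map gen).prod

theorem ofWord_cons (i : Fin n) (l : List (Fin n)) : ofWord (i :: l) = gen i * ofWord l := by
  simp [ofWord]

theorem ofWord_append (u v : List (Fin n)) : ofWord (u ++ v) = ofWord u * ofWord v := by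
  simp [ofWord]

theorem mk_ofList (l : List (Fin n)) :
    PresentedMonoid.mk (PermRel (Subgroup.zpowers (finRotate n) : Set (Equiv.Perm (Fin n))))
      (FreeMonoid.ofList l) = ofWord l := by
  induction l with
  | nil => exact map_one _
  | cons i l ih => rw [FreeMonoid.ofList_cons, map_mul, ih, ofWord_cons]; rfl

theorem exists_ofWord_eq (s : CyclicPermMonoid n) : ∃ l, ofWord l = s := by
  induction s using PresentedMonoid.inductionOn with
  | h u => exact ⟨u.toList, (mk_ofList _).symm⟩

variable [NeZero n]

/-- The homomorphism out of `S_n` given by a family whose products along all rotations agree. -/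
def lift {M : Type*} [Monoid M] (f : Fin n → M)
    (hf : ∀ j, ((cycWord j n).map f).prod = ((cycWord 0 n).map f).prod) :
    CyclicPermMonoid n →* M :=
  PresentedMonoid.lift f <| by
    rintro u v ⟨σ, hσ, rfl, rfl⟩
    obtain ⟨j, hj⟩ := mem_zpowers_finRotate_iff.1 hσ
    rw [permWord_eq_ofList_cycWord hj, permWord_eq_ofList_cycWord (j := 0) (by simp)]
    simp only [FreeMonoid.lift_ofList, hf]

theorem lift_gen {M : Type*} [Monoid M] (f : Fin n → M)
    (hf : ∀ j, ((cycWord j n).map f).prod = ((cycWord 0 n).map f).prod) (i : Fin n) :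
    lift f hf (gen i) = f i := rfl

/-- The element `a_1 a_2 ⋯ a_n`. -/
def center (n : ℕ) [NeZero n] : CyclicPermMonoid n := ofWord (cycWord 0 n)

theorem ofWord_cycWord (j : Fin n) : ofWord (cycWord j n) = center n := by
  have h1 : ∀ i, (1 : Equiv.Perm (Fin n)) i = 0 + i := by simp
  have hj : ∀ i, Equiv.addLeft j i = j + i := fun i => rfl
  rw [center, ← mk_ofList, ← mk_ofList, ← permWord_eq_ofList_cycWord h1,
    ← permWord_eq_ofList_cycWord hj]
  exact ((Con.eq _).2 (ConGen.Rel.of _ _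
    ⟨_, mem_zpowers_finRotate_iff.2 ⟨j, hj⟩, rfl, rfl⟩)).symm

theorem gen_mul_center (i : Fin n) : gen i * center n = center n * gen i := by
  have := congrArg ofWord (cycWord_card_succ i)
  rw [ofWord_cons, ofWord_append, ofWord_cycWord, ofWord_cycWord] at this
  simpa [ofWord] using this

theorem gen_mul_ofWord (i : Fin n) (l : List (Fin n)) :
    ∃ k, gen i * ofWord l = center n ^ k * ofWord (cycPush i l) := by
  by_cases h : cycWord (i + 1) (n - 1) <+: l
  · obtain ⟨v, rfl⟩ := h
    refine ⟨1, ?_⟩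
    rw [cycPush_append, ofWord_append, ← mul_assoc, ← ofWord_cons, ← cycWord_card_eq_cons,
      ofWord_cycWord, pow_one]
  · exact ⟨0, by rw [cycPush_of_not h, ofWord_cons, pow_zero, one_mul]⟩

/-- The length homomorphism. -/
def length (n : ℕ) [NeZero n] : CyclicPermMonoid n →* Multiplicative ℕ :=
  lift (fun _ => Multiplicative.ofAdd 1) fun j => by
    simp [List.map_const', length_cycWord]

theorem length_gen (i : Fin n) : length n (gen i) = Multiplicative.ofAdd 1 := rfl

theorem length_ofWord (l : List (Fin n)) :
    length n (ofWord l) = Multiplicative.ofAdd l.length := by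
  induction l with
  | nil => exact map_one _
  | cons i l ih => rw [ofWord_cons, map_mul, ih, length_gen, ← ofAdd_add, List.length_cons, add_comm]

/-- Letters act by permutations on reduced words. -/
noncomputable def pushPerm (i : Fin n) : Equiv.Perm {l : List (Fin n) // IsCycReduced l} where
  toFun l := ⟨cycPush i l.1, l.2.push i⟩
  invFun l := ⟨(cycWord (i + 1) (n - 1)).foldr cycPush l.1, by
    induction cycWord (i + 1) (n - 1) with
    | nil => exact l.2
    | cons j u ih => exact ih.push j⟩
  left_inv l := Subtype.ext <| by
    -- The rotation starting at `i + 1` ends with `i`.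
    have h := foldr_cycPush_cycWord_card l.2 (i + 1)
    rw [cycWord_card_eq_append, succ_add_card_sub_one, List.foldr_append] at h
    exact h
  right_inv l := Subtype.ext <| by
    have h := foldr_cycPush_cycWord_card l.2 i
    rw [cycWord_card_eq_cons] at h
    exact h

theorem prod_map_pushPerm_apply (u : List (Fin n)) (l : {l : List (Fin n) // IsCycReduced l}) :
    ((u.map pushPerm).prod l).1 = u.foldr cycPush l.1 := by
  induction u with
  | nil => rfl
  | cons i u ih =>
    rw [List.map_cons, List.prod_cons, Equiv.Perm.mul_apply, List.foldr_cons, ← ih]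
    rfl

theorem prod_map_pushPerm_cycWord (i : Fin n) : ((cycWord i n).map pushPerm).prod = 1 :=
  Equiv.ext fun l => Subtype.ext <| by
    rw [prod_map_pushPerm_apply, foldr_cycPush_cycWord_card l.2]
    rfl

/-- The images of the generators in a free group: the last one is the inverse of the product
of the others. -/
def freeGen (i : Fin n) : FreeGroup (Fin n) :=
  if i = ((n - 1 : ℕ) : Fin n) then ((cycWord 0 (n - 1)).map FreeGroup.of).prod⁻¹
  else FreeGroup.of i

theorem prod_map_freeGen : ((cycWord 0 n).map (freeGen (n := n))).prod = 1 := by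
  have h : (cycWord (0 : Fin n) (n - 1)).map freeGen = (cycWord 0 (n - 1)).map FreeGroup.of := by
    refine List.map_congr_left fun i hi => if_neg ?_
    rw [cycWord_eq_map] at hi
    obtain ⟨k, hk, rfl⟩ := List.mem_map.1 hi
    rw [List.mem_range] at hk
    intro he
    have := congrArg Fin.val he
    rw [zero_add, Fin.val_natCast, Fin.val_natCast, Nat.mod_eq_of_lt (by omega),
      Nat.mod_eq_of_lt (by omega)] at this
    omega
  rw [cycWord_card_eq_append, zero_add, List.map_append, List.prod_append, h]
  simp [freeGen]

theorem lift_pushPerm_freeGen (i : Fin n) : FreeGroup.lift pushPerm (freeGen i) = pushPerm i := by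
  unfold freeGen
  split_ifs with h
  · have := prod_map_pushPerm_cycWord (0 : Fin n)
    rw [cycWord_card_eq_append, zero_add, List.map_append, List.prod_append] at this
    rw [h, map_inv, map_list_prod, List.map_map, inv_eq_iff_mul_eq_one]
    convert this using 2
    · congr 2
    · simp
  · simp

/-- The homomorphism from `S_n` to a free group that sends `a_1 ⋯ a_n` to `1`. -/
def toFreeGroup (n : ℕ) [NeZero n] : CyclicPermMonoid n →* FreeGroup (Fin n) :=
  lift freeGen fun j => by
    rw [prod_map_freeGen, prod_map_cycWord_eq_one prod_map_freeGen]

/-- The reduced word is the orbit point of the empty word, so it depends on `s` only through the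
free group. -/
theorem exists_eq_center_pow_mul (s : CyclicPermMonoid n) : ∃ k, s = center n ^ k *
    ofWord (FreeGroup.lift pushPerm (toFreeGroup n s) ⟨[], trivial⟩).1 := by
  obtain ⟨l, rfl⟩ := exists_ofWord_eq s
  induction l with
  | nil => exact ⟨0, by simp [ofWord]⟩
  | cons i l ih =>
    obtain ⟨k, hk⟩ := ih
    set w := FreeGroup.lift pushPerm (toFreeGroup n (ofWord l)) ⟨[], trivial⟩ with hw
    obtain ⟨m, hm⟩ := gen_mul_ofWord i w.1
    refine ⟨k + m, ?_⟩
    have hp : FreeGroup.lift pushPerm (toFreeGroup n (ofWord (i :: l))) ⟨[], trivial⟩ =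
        pushPerm i w := by
      rw [ofWord_cons, map_mul, map_mul, Equiv.Perm.mul_apply, ← hw, toFreeGroup, lift_gen,
        lift_pushPerm_freeGen]
    have hc : gen i * center n ^ k = center n ^ k * gen i :=
      ((show Commute (gen i) (center n) from gen_mul_center i).pow_right k).eq
    rw [hp, ofWord_cons, hk, ← mul_assoc, hc, mul_assoc, hm, pow_add, mul_assoc]
    rfl

theorem toFreeGroup_prod_length_injective :
    Function.Injective ((toFreeGroup n).prod (length n)) := by
  intro s t hst
  obtain ⟨h1, h2⟩ := Prod.mk.inj hst
  obtain ⟨k, hk⟩ := exists_eq_center_pow_mul s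
  obtain ⟨m, hm⟩ := exists_eq_center_pow_mul t
  rw [← h1] at hm
  rw [hk, hm, map_mul, map_mul, mul_left_inj, map_pow, map_pow, center, length_ofWord,
    length_cycWord, ← ofAdd_nsmul, ← ofAdd_nsmul] at h2
  have hkm : k = m := by
    have h3 := Multiplicative.ofAdd.injective h2
    exact Nat.eq_of_mul_eq_mul_right (NeZero.pos n) (by simpa using h3)
  rw [hk, hm, hkm]

theorem uniqueProds : UniqueProds (CyclicPermMonoid n) := by
  have := uniqueProds_freeGroup (Fin n)
  exact UniqueProds.of_injective_mulHom ((toFreeGroup n).prod (length n)).toMulHom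
    toFreeGroup_prod_length_injective inferInstance

end CyclicPermMonoid

/-! ### Semiprimitivity by degree -/

open Polynomial in
/-- A monoid algebra without zero divisors over a field is semiprimitive if the monoid has a
homomorphism to `ℕ` which is not identically zero. -/
theorem MonoidAlgebra.jacobson_eq_bot_of_length {K M : Type*} [Field K] [Monoid M]
    [IsDomain (MonoidAlgebra K M)] (ℓ : M →* Multiplicative ℕ) (a : M) (ha : ℓ a ≠ 1) :
    Ring.jacobson (MonoidAlgebra K M) = ⊥ := by
  -- The grading by `ℓ` is recorded as the degree in `X`; evaluation at `1` undoes it.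
  let Φ : MonoidAlgebra K M →ₐ[K] (MonoidAlgebra K M)[X] :=
    MonoidAlgebra.lift K _ M
      { toFun := fun s => Polynomial.monomial (ℓ s).toAdd (MonoidAlgebra.of K M s)
        map_one' := by
          rw [map_one ℓ, map_one (MonoidAlgebra.of K M), toAdd_one, Polynomial.monomial_zero_one]
        map_mul' := fun s t => by
          rw [Polynomial.monomial_mul_monomial, map_mul ℓ, map_mul (MonoidAlgebra.of K M), toAdd_mul] }
  have hΦ (s : M) : Φ (MonoidAlgebra.of K M s) =
      Polynomial.monomial (ℓ s).toAdd (MonoidAlgebra.of K M s) := by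
    exact MonoidAlgebra.lift_of _ _
  have hinj : Function.Injective Φ := by
    refine Function.LeftInverse.injective (g := Polynomial.eval 1) fun x => ?_
    induction x using MonoidAlgebra.induction_on with
    | of s => rw [hΦ]; simp
    | add x y hx hy => rw [map_add, Polynomial.eval_add, hx, hy]
    | smul r x hx => rw [map_smul, Polynomial.eval_smul, hx]
  rw [← Ideal.jacobson_bot, eq_bot_iff]
  intro x hx
  rw [Ideal.mem_bot]
  by_contra hx0
  obtain ⟨z, hz⟩ := Ideal.mem_jacobson_iff.1 hx (MonoidAlgebra.of K M a)
  rw [Ideal.mem_bot, sub_eq_zero] at hz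
  have ha0 : (MonoidAlgebra.of K M a : MonoidAlgebra K M) ≠ 0 := by simp
  have hΦx : Φ x ≠ 0 := (map_ne_zero_iff Φ hinj).2 hx0
  have hdeg : 0 < (Φ (MonoidAlgebra.of K M a * x)).natDegree := by
    rw [map_mul, Polynomial.natDegree_mul ((map_ne_zero_iff Φ hinj).2 ha0) hΦx, hΦ,
      Polynomial.natDegree_monomial_eq _ ha0]
    exact Nat.add_pos_left (Nat.pos_of_ne_zero fun h => ha (by simpa using h)) _
  have h1 : Φ z * (Φ (MonoidAlgebra.of K M a * x) + 1) = 1 := by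
    rw [← map_one Φ, ← map_add, ← map_mul, mul_add, mul_one, ← mul_assoc, hz]
  have hne := mul_ne_zero_iff.1 (h1.trans_ne one_ne_zero)
  have h2 := congrArg Polynomial.natDegree h1
  rw [Polynomial.natDegree_mul hne.1 hne.2, ← Polynomial.C_1, Polynomial.natDegree_add_C,
    Polynomial.natDegree_C] at h2
  omega

theorem mainTheorem3 (K : Type*) [Field K] (n : ℕ) (hn : 3 ≤ n) :
    IsDomain (MonoidAlgebra K (CyclicPermMonoid n)) ∧
      Ring.jacobson (MonoidAlgebra K (CyclicPermMonoid n)) = ⊥ := by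
  have : NeZero n := ⟨by omega⟩
  have := CyclicPermMonoid.uniqueProds (n := n)
  have hdom : IsDomain (MonoidAlgebra K (CyclicPermMonoid n)) :=
    NoZeroDivisors.to_isDomain _
  refine ⟨hdom, MonoidAlgebra.jacobson_eq_bot_of_length (CyclicPermMonoid.length n)
    (CyclicPermMonoid.gen 0) ?_⟩
  rw [CyclicPermMonoid.length_gen]
  decide
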